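/- A \emph{pseudotopological space} is a set $X$ with a relation $\lambda\to x$ between (proper) filters $\lambda$ on $X$ and points $x\in X$ such that: the principal filter $\dot x$ converges to $x$ for every $x$; if $\lambda\to x$ and $\lambda\subset\lambda'$ then $\lambda'\to x$; and $\lambda\to x$ whenever every ultrafilter containing $\lambda$ converges to $x$. A map is \emph{continuous} if it sends filters converging to $x$ to filters generating a filter converging to the image of $x$; $\mathbf{PsTop}$ is the resulting category. Topological spaces are regarded as pseudotopological spaces through $\lambda\to x$ iff $\lambda$ contains the neighborhood filter of $x$. Let $I=[0,1]$ with its usual topology. Products, coproducts and quotients are taken in $\mathbf{PsTop}$: a filter on a product converges iff its projections do; coproducts and quotients carry the finest pseudotopologies making the canonical maps continuous. Maps $p,q\colon A\to B$ are \emph{homotopic} if there is a continuous $H\colon A\times I\to B$ with $H(a,0)=p(a)$ and $H(a,1)=q(a)$, and a continuous map is a \emph{homotopy equivalence} if it has a continuous inverse up to homotopy on both sides. Let $f\colon X\to Y$ be a continuous map of pseudotopological spaces and let $$M_f=\bigl((X\times I)\sqcup Y\bigr)/\bigl((x,0)\sim f(x)\bigr)$$ be its mapping cylinder, with the maps $g\colon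 X\times I\to M_f$, $g(x,t)=[x,t]$, and $j\colon Y\to M_f$, $j(y)=[y]$. Then: 1. the square formed by $i_0\colon X\to X\times I$, $i_0(x)=(x,0)$, together with $f$, $g$ and $j$, is a pushout in $\mathbf{PsTop}$; 2. the map $i\colon X\to M_f$, $i(x)=g(x,1)=[x,1]$, is the inclusion of a subspace: it is injective, and a filter $\lambda$ on $X$ converges to $x$ if and only if the filter generated by $i(\lambda)$ converges to $i(x)$; 3. there is a continuous map $r\colon M_f\to Y$ with $r([x,t])=f(x)$ and $r([y])=y$; it satisfies $f=r\circ i$, and $r$ is a homotopy equivalence. -/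

import Mathlib

open CategoryTheory Filter

universe u

/-- A pseudotopology on `X`: a relation `Conv F x` (`F` converges to `x`) between filters and points
such that point filters converge to their point, every filter finer than a filter converging to `x`
converges to `x`, and a filter converges to `x` as soon as all finer ultrafilters do.
In Mathlib `F ≤ G` means that `F` is finer than `G` (every member of `G` is a member of `F`).
Mathlib also has the improper filter `⊥`, below which there is no ultrafilter; by the third axiom it
converges to every point, so the relation carries exactly the information of its
restriction to proper filters. -/
class PseudotopologicalSpace (X : Type u) where
  Conv : Filter X → X → Prop
  conv_pure : ∀ x, Conv (pure x) x
  conv_mono : ∀ {F G : Filter X} {x : X}, F ≤ G → Conv G x → Conv F x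
  conv_of_ultrafilter : ∀ {F : Filter X} {x : X},
    (∀ U : Ultrafilter X, (U : Filter X) ≤ F → Conv (U : Filter X) x) → Conv F x

namespace PseudotopologicalSpace

/-- Continuity of a map of pseudotopological spaces. -/
def IsContinuous {X Y : Type*} [PseudotopologicalSpace X] [PseudotopologicalSpace Y]
    (f : X → Y) : Prop :=
  ∀ (F : Filter X) (x : X), Conv F x → Conv (map f F) (f x)

/-- `i` identifies `X` with a subspace of `Y`: it is injective, and a filter converges in `X`
if and only if the filter it generates converges in `Y`. -/
def IsInclusion {X Y : Type*} [PseudotopologicalSpace X] [PseudotopologicalSpace Y]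
    (i : X → Y) : Prop :=
  Function.Injective i ∧ ∀ (F : Filter X) (x : X), Conv F x ↔ Conv (map i F) (i x)

/-- A topological space as a pseudotopological space: `F` converges to `x` if and only if `F` is
finer than the neighborhood filter of `x`. -/
@[reducible] def ofTopologicalSpace (X : Type*) [TopologicalSpace X] :
    PseudotopologicalSpace X where
  Conv F x := F ≤ nhds x
  conv_pure x := pure_le_nhds x
  conv_mono h h' := h.trans h'
  conv_of_ultrafilter h := le_iff_ultrafilter.2 fun U hU => h U hU

/-- The topological unit interval. -/
instance instUnitInterval : PseudotopologicalSpace unitInterval := ofTopologicalSpace unitInterval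

/-- An ultrafilter finer than `map f F` is the image of an ultrafilter finer than `F`. -/
theorem exists_ultrafilter_lift {X Y : Type*} {f : X → Y} {F : Filter X} {U : Ultrafilter Y}
    (hU : (U : Filter Y) ≤ map f F) : ∃ V : Ultrafilter X, (V : Filter X) ≤ F ∧ V.map f = U := by
  have h : map f (F ⊓ comap f U) = U := by rw [Filter.push_pull, inf_eq_right.2 hU]
  have hne : (F ⊓ comap f (U : Filter Y)).NeBot := by
    rw [← map_neBot_iff f, h]; infer_instance
  refine ⟨Ultrafilter.of (F ⊓ comap f U), (Ultrafilter.of_le _).trans inf_le_left, ?_⟩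
  rw [← Ultrafilter.coe_le_coe, Ultrafilter.coe_map]
  exact (map_mono (Ultrafilter.of_le _)).trans h.le

/-- The product: a filter converges if and only if both of its projections do. -/
instance instProd {X Y : Type*} [PseudotopologicalSpace X] [PseudotopologicalSpace Y] :
    PseudotopologicalSpace (X × Y) where
  Conv F p := Conv (map Prod.fst F) p.1 ∧ Conv (map Prod.snd F) p.2
  conv_pure p := by simpa only [map_pure] using ⟨conv_pure p.1, conv_pure p.2⟩
  conv_mono h h' := ⟨conv_mono (map_mono h) h'.1, conv_mono (map_mono h) h'.2⟩
  conv_of_ultrafilter {F p} h := by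
    constructor
    · refine conv_of_ultrafilter fun U hU => ?_
      obtain ⟨V, hV, rfl⟩ := exists_ultrafilter_lift hU
      exact (h V hV).1
    · refine conv_of_ultrafilter fun U hU => ?_
      obtain ⟨V, hV, rfl⟩ := exists_ultrafilter_lift hU
      exact (h V hV).2

theorem isContinuous_prodMk_const {X Y : Type*} [PseudotopologicalSpace X]
    [PseudotopologicalSpace Y] (y : Y) : IsContinuous fun x : X => (x, y) := fun F x h =>
  ⟨by rw [map_map]; exact conv_mono map_id.le h,
    conv_mono (by rw [map_map]; exact tendsto_const_pure) (conv_pure y)⟩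

/-- The final pseudotopology along a map `q` onto `Z`: an ultrafilter converges to `z` if and only
if it is finer than the image of a filter converging to some `w` with `q w = z`, and a
filter converges to `z` if and only if all finer ultrafilters do. -/
@[reducible] def coinduced {W Z : Type*} [PseudotopologicalSpace W] (q : W → Z)
    (hq : Function.Surjective q) : PseudotopologicalSpace Z where
  Conv F z := ∀ U : Ultrafilter Z, (U : Filter Z) ≤ F →
    ∃ (G : Filter W) (w : W), Conv G w ∧ q w = z ∧ (U : Filter Z) ≤ map q G
  conv_pure z U hU := by
    obtain ⟨w, rfl⟩ := hq z
    exact ⟨pure w, w, conv_pure w, rfl, by simpa only [map_pure] using hU⟩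
  conv_mono h h' U hU := h' U (hU.trans h)
  conv_of_ultrafilter h U hU := h U hU U le_rfl

/-- The coproduct: a filter converges to a point of a summand if and only if it is finer than the
image of a filter converging to that point in the summand. -/
instance instSum {X Y : Type*} [PseudotopologicalSpace X] [PseudotopologicalSpace Y] :
    PseudotopologicalSpace (X ⊕ Y) where
  Conv F p := Sum.elim (fun x => ∃ G : Filter X, Conv G x ∧ F ≤ map Sum.inl G)
    (fun y => ∃ G : Filter Y, Conv G y ∧ F ≤ map Sum.inr G) p
  conv_pure p := by
    rcases p with x | y
    · exact ⟨pure x, conv_pure x, by simp⟩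
    · exact ⟨pure y, conv_pure y, by simp⟩
  conv_mono {F G p} h h' := by
    rcases p with x | y
    · obtain ⟨K, hK, hle⟩ := h'
      exact ⟨K, hK, h.trans hle⟩
    · obtain ⟨K, hK, hle⟩ := h'
      exact ⟨K, hK, h.trans hle⟩
  conv_of_ultrafilter {F p} h := by
    rcases p with x | y
    · have hr : Set.range (Sum.inl : X → X ⊕ Y) ∈ F := mem_iff_ultrafilter.2 fun U hU => by
        obtain ⟨G, -, hle⟩ := h U hU
        exact hle range_mem_map
      refine ⟨comap Sum.inl F, conv_of_ultrafilter fun U hU => ?_, (map_comap_of_mem hr).ge⟩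
      obtain ⟨G, hG, hle⟩ := h (U.map Sum.inl) (map_le_iff_le_comap.2 hU)
      exact conv_mono ((map_le_map_iff Sum.inl_injective).1 hle) hG
    · have hr : Set.range (Sum.inr : Y → X ⊕ Y) ∈ F := mem_iff_ultrafilter.2 fun U hU => by
        obtain ⟨G, -, hle⟩ := h U hU
        exact hle range_mem_map
      refine ⟨comap Sum.inr F, conv_of_ultrafilter fun U hU => ?_, (map_comap_of_mem hr).ge⟩
      obtain ⟨G, hG, hle⟩ := h (U.map Sum.inr) (map_le_iff_le_comap.2 hU)
      exact conv_mono ((map_le_map_iff Sum.inr_injective).1 hle) hG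

/-- The quotient by (the equivalence relation generated by) a relation. -/
instance instQuot {W : Type*} [PseudotopologicalSpace W] (r : W → W → Prop) :
    PseudotopologicalSpace (Quot r) :=
  coinduced (Quot.mk r) Quot.mk_surjective

theorem isContinuous_inl {X Y : Type*} [PseudotopologicalSpace X] [PseudotopologicalSpace Y] :
    IsContinuous (Sum.inl : X → X ⊕ Y) := fun F _ h => ⟨F, h, le_rfl⟩

theorem isContinuous_inr {X Y : Type*} [PseudotopologicalSpace X] [PseudotopologicalSpace Y] :
    IsContinuous (Sum.inr : Y → X ⊕ Y) := fun F _ h => ⟨F, h, le_rfl⟩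

theorem isContinuous_quotMk {W : Type*} [PseudotopologicalSpace W] (r : W → W → Prop) :
    IsContinuous (Quot.mk r) := fun F w h _ hU => ⟨F, w, h, rfl, hU⟩

/-- The quotient carries the finest pseudotopology that makes the quotient map continuous. -/
theorem isContinuous_quot_iff {W Z : Type*} [PseudotopologicalSpace W] [PseudotopologicalSpace Z]
    (r : W → W → Prop) (k : Quot r → Z) :
    IsContinuous k ↔ IsContinuous fun w => k (Quot.mk r w) := by
  constructor
  · intro hk F w h
    have := hk _ _ (isContinuous_quotMk r F w h)
    rwa [map_map] at this
  · intro hk F z h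
    refine conv_of_ultrafilter fun U hU => ?_
    obtain ⟨V, hV, rfl⟩ := exists_ultrafilter_lift hU
    obtain ⟨G, w, hG, rfl, hle⟩ := h V hV
    refine conv_mono (map_mono hle) ?_
    rw [map_map]
    exact hk G w hG

end PseudotopologicalSpace

open PseudotopologicalSpace

/-- The category of pseudotopological spaces and continuous maps: objects. -/
structure PsTop where
  carrier : Type u
  [str : PseudotopologicalSpace carrier]

namespace PsTop

instance (X : PsTop.{u}) : PseudotopologicalSpace X.carrier := X.str

/-- Continuous maps, the morphisms of `PsTop`. -/
@[ext] structure Map (X Y : PsTop.{u}) where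
  toFun : X.carrier → Y.carrier
  continuous : IsContinuous toFun

instance (X Y : PsTop.{u}) : FunLike (Map X Y) X.carrier Y.carrier where
  coe := Map.toFun
  coe_injective _ _ h := Map.ext h

instance : Category PsTop.{u} where
  Hom := Map
  id X := ⟨id, fun F x h => by simpa only [map_id, id] using h⟩
  comp f g := ⟨g.toFun ∘ f.toFun, fun F x h => by
    have := g.continuous _ _ (f.continuous F x h)
    rwa [map_map] at this⟩

instance : ConcreteCategory PsTop.{u} Map where
  hom f := f
  ofHom f := f

/-- A continuous function as a morphism of `PsTop`. -/
def ofHom {X Y : PsTop.{u}} (f : X.carrier → Y.carrier) (hf : IsContinuous f) : X ⟶ Y :=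
  Map.mk f hf

/-- The cylinder `X × I`, where `I` is the topological unit interval. -/
abbrev cyl (X : PsTop.{u}) : PsTop.{u} := ⟨X.carrier × unitInterval⟩

/-- The map `x ↦ (x, t)`. -/
def cylIncl (X : PsTop.{u}) (t : unitInterval) : X ⟶ cyl X :=
  ofHom (Y := cyl X) (fun x => (x, t)) (isContinuous_prodMk_const t)

/-- The inclusion `x ↦ (x, 0)`. -/
abbrev i₀ (X : PsTop.{u}) : X ⟶ cyl X := cylIncl X 0

/-- The inclusion `x ↦ (x, 1)`. -/
abbrev i₁ (X : PsTop.{u}) : X ⟶ cyl X := cylIncl X 1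

/-- Homotopy of continuous maps. -/
def Homotopic {X Y : PsTop.{u}} (f g : X ⟶ Y) : Prop :=
  ∃ H : cyl X ⟶ Y, i₀ X ≫ H = f ∧ i₁ X ≫ H = g

/-- `f` is a homotopy equivalence: it has a homotopy inverse. -/
def IsHomotopyEquivalence {X Y : PsTop.{u}} (f : X ⟶ Y) : Prop :=
  ∃ g : Y ⟶ X, Homotopic (g ≫ f) (𝟙 Y) ∧ Homotopic (f ≫ g) (𝟙 X)

/-- The relation `(x, 0) ∼ f x` on the coproduct of `X × I` and `Y`. -/
def mapCylRel {X Y : PsTop.{u}} (f : X ⟶ Y) (a b : (cyl X).carrier ⊕ Y.carrier) : Prop :=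
  ∃ x : X.carrier, a = Sum.inl (i₀ X x) ∧ b = Sum.inr (f x)

/-- The mapping cylinder of `f`: the quotient of the coproduct of `X × I` and `Y` by the
equivalence relation generated by `(x, 0) ∼ f x`. -/
abbrev mapCyl {X Y : PsTop.{u}} (f : X ⟶ Y) : PsTop.{u} := ⟨Quot (mapCylRel f)⟩

/-- The map `(x, t) ↦ [x, t]`. -/
def mapCylG {X Y : PsTop.{u}} (f : X ⟶ Y) : cyl X ⟶ mapCyl f :=
  ofHom (Y := mapCyl f) (fun p => Quot.mk (mapCylRel f) (Sum.inl p)) fun F p h =>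
    isContinuous_quotMk (mapCylRel f) _ _ (isContinuous_inl F p h)

/-- The map `y ↦ [y]`. -/
def mapCylJ {X Y : PsTop.{u}} (f : X ⟶ Y) : Y ⟶ mapCyl f :=
  ofHom (Y := mapCyl f) (fun y => Quot.mk (mapCylRel f) (Sum.inr y)) fun F y h =>
    isContinuous_quotMk (mapCylRel f) _ _ (isContinuous_inr F y h)

/-- The map `x ↦ [x, 1]`. -/
def mapCylI {X Y : PsTop.{u}} (f : X ⟶ Y) : X ⟶ mapCyl f := i₁ X ≫ mapCylG f

end PsTop

namespace PseudotopologicalSpace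

/-! The pushout property combines the universal properties of the coproduct and the quotient. For
the inclusion, an ultrafilter converging to `[x, 1]` is finer than the image of a filter converging
to some representative. As `1 ≠ 0`, the only representative is `(x, 1)`, and such a filter
eventually avoids `t = 0`. There the coordinates of `[x, t]` can be read off by `mapCylCoord`, so
convergence descends to `X`. The retraction has `mapCylJ` as homotopy inverse, by sliding `[x, t]`
to `[x, t * s]`. Continuity of this homotopy rests on `isContinuous_sum_prod` and
`isContinuous_quot_prod`: in `PsTop`, products with any fixed space preserve coproducts and
quotients, with no compactness assumption. -/

theorem IsContinuous.comp {X Y Z : Type*} [PseudotopologicalSpace X] [PseudotopologicalSpace Y]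
    [PseudotopologicalSpace Z] {g : Y → Z} {f : X → Y} (hg : IsContinuous g)
    (hf : IsContinuous f) : IsContinuous fun x => g (f x) := fun F x h => by
  have := hg _ _ (hf F x h)
  rwa [map_map] at this

theorem isContinuous_fst {X Y : Type*} [PseudotopologicalSpace X] [PseudotopologicalSpace Y] :
    IsContinuous (Prod.fst : X × Y → X) := fun _ _ h => h.1

theorem isContinuous_snd {X Y : Type*} [PseudotopologicalSpace X] [PseudotopologicalSpace Y] :
    IsContinuous (Prod.snd : X × Y → Y) := fun _ _ h => h.2

theorem IsContinuous.prodMk {X Y Z : Type*} [PseudotopologicalSpace X] [PseudotopologicalSpace Y]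
    [PseudotopologicalSpace Z] {f : X → Y} {g : X → Z} (hf : IsContinuous f)
    (hg : IsContinuous g) : IsContinuous fun x => (f x, g x) := fun F x h =>
  ⟨by rw [map_map]; exact hf F x h, by rw [map_map]; exact hg F x h⟩

theorem conv_prod {X Y : Type*} [PseudotopologicalSpace X] [PseudotopologicalSpace Y]
    {F : Filter X} {G : Filter Y} {x : X} {y : Y} (hF : Conv F x) (hG : Conv G y) :
    Conv (F ×ˢ G) (x, y) :=
  ⟨conv_mono tendsto_fst hF, conv_mono tendsto_snd hG⟩

/-- A filter on a product is finer than the product of its projections, so a bound on the first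
projection alone lifts the filter along `e`. -/
theorem le_map_prodMap {A B T : Type*} {e : A → B} {F : Filter (B × T)} {G : Filter A}
    (h : map Prod.fst F ≤ map e G) : F ≤ map (Prod.map e id) (G ×ˢ map Prod.snd F) := by
  rw [← prod_map_map_eq', map_id]
  exact le_prod.2 ⟨h, le_rfl⟩

/-- Functions on a coproduct are continuous if their restrictions to the summands are. -/
theorem isContinuous_sum {X Y Z : Type*} [PseudotopologicalSpace X] [PseudotopologicalSpace Y]
    [PseudotopologicalSpace Z] {k : X ⊕ Y → Z} (hl : IsContinuous fun x => k (Sum.inl x))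
    (hr : IsContinuous fun y => k (Sum.inr y)) : IsContinuous k := by
  rintro F (x | y) ⟨G, hG, hle⟩
  · exact conv_mono ((map_mono hle).trans_eq map_map) (hl G x hG)
  · exact conv_mono ((map_mono hle).trans_eq map_map) (hr G y hG)

/-- Products with a fixed space distribute over coproducts. -/
theorem isContinuous_sum_prod {X Y T Z : Type*} [PseudotopologicalSpace X]
    [PseudotopologicalSpace Y] [PseudotopologicalSpace T] [PseudotopologicalSpace Z]
    {k : (X ⊕ Y) × T → Z} (hl : IsContinuous fun p : X × T => k (Sum.inl p.1, p.2))
    (hr : IsContinuous fun p : Y × T => k (Sum.inr p.1, p.2)) : IsContinuous k := by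
  rintro F ⟨x | y, t⟩ ⟨⟨G, hG, hle⟩, ht⟩
  · exact conv_mono ((map_mono (le_map_prodMap hle)).trans_eq map_map)
      (hl _ (x, t) (conv_prod hG ht))
  · exact conv_mono ((map_mono (le_map_prodMap hle)).trans_eq map_map)
      (hr _ (y, t) (conv_prod hG ht))

/-- The product of a quotient map with the identity of a fixed space is a quotient map. -/
theorem isContinuous_quot_prod {W T Z : Type*} [PseudotopologicalSpace W]
    [PseudotopologicalSpace T] [PseudotopologicalSpace Z] {r : W → W → Prop}
    {k : Quot r × T → Z} (hk : IsContinuous fun p : W × T => k (Quot.mk r p.1, p.2)) :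
    IsContinuous k := by
  rintro F ⟨z, t⟩ ⟨hz, ht⟩
  -- Convergence in a quotient provides a filter upstairs only for each ultrafilter. The first
  -- projection of an ultrafilter on the product is again one, so `hz` applies to it.
  refine conv_of_ultrafilter fun U hU => ?_
  obtain ⟨V, hV, rfl⟩ := exists_ultrafilter_lift hU
  obtain ⟨G, w, hG, rfl, hle⟩ := hz (V.map Prod.fst) (map_mono hV)
  exact conv_mono ((map_mono (le_map_prodMap hle)).trans_eq map_map)
    (hk _ (w, t) (conv_prod hG (conv_mono (map_mono hV) ht)))

theorem isContinuous_unitInterval_mul :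
    IsContinuous fun p : unitInterval × unitInterval => p.1 * p.2 := fun F _ h =>
  Tendsto.mul (f := fun p : unitInterval × unitInterval => p.1) (x := F) h.1 h.2

end PseudotopologicalSpace

namespace PsTop

variable {X Y Z : PsTop.{u}}

theorem hom_ext {f g : X ⟶ Y} (h : ∀ x, f x = g x) : f = g :=
  Map.ext (funext h)

theorem mapCyl_glue (f : X ⟶ Y) (x : X.carrier) : mapCylG f (x, 0) = mapCylJ f (f x) :=
  Quot.sound ⟨x, rfl, rfl⟩

theorem mapCyl_ind {f : X ⟶ Y} {P : (mapCyl f).carrier → Prop}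
    (hg : ∀ x t, P (mapCylG f (x, t))) (hj : ∀ y, P (mapCylJ f y)) (z : (mapCyl f).carrier) :
    P z :=
  Quot.ind (fun w => match w with
    | Sum.inl p => hg p.1 p.2
    | Sum.inr y => hj y) z

/-- The morphism out of the mapping cylinder determined by compatible morphisms on `X × I`
and `Y`. -/
def mapCylDesc (f : X ⟶ Y) (h : cyl X ⟶ Z) (k : Y ⟶ Z) (w : ∀ x, h (x, 0) = k (f x)) :
    mapCyl f ⟶ Z :=
  ofHom (X := mapCyl f)
    (Quot.lift (Sum.elim h k) (by rintro _ _ ⟨x, rfl, rfl⟩; exact w x))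
    ((isContinuous_quot_iff _ _).2 (isContinuous_sum h.continuous k.continuous))

theorem isPushout_mapCyl (f : X ⟶ Y) : IsPushout (i₀ X) f (mapCylG f) (mapCylJ f) where
  w := hom_ext (mapCyl_glue f)
  isColimit' := ⟨Limits.PushoutCocone.IsColimit.mk _
    (fun s => mapCylDesc f s.inl s.inr fun x => congrArg (fun m : X ⟶ s.pt => m x) s.condition)
    (fun _ => rfl) (fun _ => rfl)
    (fun s _ hl hr => hom_ext (mapCyl_ind
      (fun x t => congrArg (fun m : cyl X ⟶ s.pt => m (x, t)) hl)
      (fun y => congrArg (fun m : Y ⟶ s.pt => m y) hr)))⟩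

open Classical in
/-- The partial inverse of `(x, t) ↦ [x, t]`, defined off the image of `Y`. -/
noncomputable def mapCylCoord (f : X ⟶ Y) :
    (mapCyl f).carrier → Option (X.carrier × unitInterval) :=
  -- Both `(x, 0)` and `f x` get the value `none`, so the function respects the gluing.
  Quot.lift (Sum.elim (fun p => if p.2 = 0 then none else some p) fun _ => none) (by
    rintro _ _ ⟨x, rfl, rfl⟩
    exact if_pos rfl)

theorem mapCylCoord_mapCylG (f : X ⟶ Y) {p : X.carrier × unitInterval} (hp : p.2 ≠ 0) :
    mapCylCoord f (mapCylG f p) = some p :=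
  if_neg hp

theorem mapCylCoord_mapCylI (f : X ⟶ Y) (x : X.carrier) :
    mapCylCoord f (mapCylI f x) = some (x, 1) :=
  mapCylCoord_mapCylG f (p := (x, 1)) one_ne_zero

/-- Gluing only affects `t = 0`, so the class of `(x, 1)` is a singleton: any other representative
would need the coordinate `some (x, 1)` too. -/
theorem eq_of_mk_eq_mapCylI (f : X ⟶ Y) {w : (cyl X).carrier ⊕ Y.carrier} {x : X.carrier}
    (h : Quot.mk (mapCylRel f) w = mapCylI f x) : w = Sum.inl (x, 1) := by
  have h' := (congrArg (mapCylCoord f) h).trans (mapCylCoord_mapCylI f x)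
  rcases w with p | y
  · change (if p.2 = 0 then none else some p) = _ at h'
    split_ifs at h' with hp
    exact congrArg Sum.inl (Option.some.inj h')
  · exact absurd h' (Option.some_ne_none _).symm

theorem isInclusion_mapCylI (f : X ⟶ Y) : IsInclusion (mapCylI f) := by
  refine ⟨fun x x' h => ?_, fun F x => ⟨(mapCylI f).continuous F x, fun h => ?_⟩⟩
  · have h' := congrArg (mapCylCoord f) h
    rw [mapCylCoord_mapCylI, mapCylCoord_mapCylI] at h'
    exact congrArg Prod.fst (Option.some.inj h')
  refine conv_of_ultrafilter fun U hU => ?_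
  obtain ⟨G, w, hG, hw, hle⟩ := h (U.map (mapCylI f)) (map_mono hU)
  obtain rfl := eq_of_mk_eq_mapCylI f hw
  obtain ⟨K, hK, hGK⟩ := hG
  -- It suffices that `U` is finer than the first projection of `K`. The comparison is made after
  -- applying `some`, since `mapCylCoord` takes values in an `Option`.
  refine conv_mono ((map_le_map_iff (Option.some_injective _)).1 ?_) hK.1
  -- The second projection of `K` converges to `1`, and the points other than `0` form a
  -- neighborhood of `1`.
  have hpos : ∀ᶠ p in K, p.2 ≠ 0 :=
    Filter.Tendsto.eventually_ne (Y := unitInterval) (g := Prod.snd) (l := K) hK.2 one_ne_zero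
  have hle' : map (mapCylI f) U ≤ map (mapCylG f) K :=
    hle.trans ((map_mono hGK).trans_eq map_map)
  have := map_mono (m := fun z => (mapCylCoord f z).map Prod.fst) hle'
  rw [map_map, map_map] at this
  refine le_trans (le_of_eq (Filter.map_congr ?_)) (this.trans (le_of_eq ?_))
  · exact Eventually.of_forall fun x => (congrArg (Option.map Prod.fst)
      (mapCylCoord_mapCylI f x)).symm
  · rw [map_map]
    exact Filter.map_congr (hpos.mono fun p hp => congrArg (Option.map Prod.fst)
      (mapCylCoord_mapCylG f hp))

/-- The retraction of the mapping cylinder onto the target. -/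
def mapCylRetract (f : X ⟶ Y) : mapCyl f ⟶ Y :=
  mapCylDesc f (ofHom (X := cyl X) (fun p => f p.1) (f.continuous.comp isContinuous_fst)) (𝟙 Y)
    fun _ => rfl

/-- The contraction of the mapping cylinder, `([x, t], s) ↦ [x, t * s]` and `([y], s) ↦ [y]`. -/
def mapCylContract (f : X ⟶ Y) : cyl (mapCyl f) ⟶ mapCyl f :=
  ofHom (X := cyl (mapCyl f)) (Y := mapCyl f)
    (fun q => Quot.lift
      (Sum.elim (fun p => mapCylG f (p.1, p.2 * q.2)) (mapCylJ f)) (by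
        rintro _ _ ⟨x, rfl, rfl⟩
        change mapCylG f (x, 0 * q.2) = mapCylJ f (f x)
        rw [zero_mul, mapCyl_glue]) q.1)
    (isContinuous_quot_prod (isContinuous_sum_prod
      ((mapCylG f).continuous.comp ((isContinuous_fst.comp isContinuous_fst).prodMk
        (isContinuous_unitInterval_mul.comp
          ((isContinuous_snd.comp isContinuous_fst).prodMk isContinuous_snd))))
      ((mapCylJ f).continuous.comp isContinuous_fst)))

theorem homotopic_refl (f : X ⟶ Y) : Homotopic f f :=
  ⟨ofHom (X := cyl X) (fun p => f p.1) (f.continuous.comp isContinuous_fst), rfl, rfl⟩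

theorem isHomotopyEquivalence_mapCylRetract (f : X ⟶ Y) :
    IsHomotopyEquivalence (mapCylRetract f) := by
  -- `mapCylJ f` is a strict section of the retraction, so a constant homotopy serves on `Y`. On the
  -- cylinder, the contraction is `mapCylRetract f ≫ mapCylJ f` at `s = 0` and the identity at `s =
  -- 1`.
  refine ⟨mapCylJ f, homotopic_refl (𝟙 Y), mapCylContract f, hom_ext ?_, hom_ext ?_⟩
  · refine mapCyl_ind (fun x t => ?_) fun y => rfl
    change mapCylG f (x, t * 0) = mapCylJ f (f x)
    rw [mul_zero, mapCyl_glue]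
  · refine mapCyl_ind (fun x t => ?_) fun y => rfl
    change mapCylG f (x, t * 1) = mapCylG f (x, t)
    rw [mul_one]

end PsTop

theorem mainTheorem6 {X Y : PsTop.{u}} (f : X ⟶ Y) :
    IsPushout (PsTop.i₀ X) f (PsTop.mapCylG f) (PsTop.mapCylJ f) ∧
    PseudotopologicalSpace.IsInclusion (PsTop.mapCylI f) ∧
    ∃ r : PsTop.mapCyl f ⟶ Y,
      (∀ (x : X.carrier) (t : unitInterval), r (PsTop.mapCylG f (x, t)) = f x) ∧
      (∀ y : Y.carrier, r (PsTop.mapCylJ f y) = y) ∧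
      f = PsTop.mapCylI f ≫ r ∧
      PsTop.IsHomotopyEquivalence r :=
  ⟨PsTop.isPushout_mapCyl f, PsTop.isInclusion_mapCylI f, PsTop.mapCylRetract f,
    fun _ _ => rfl, fun _ => rfl, rfl, PsTop.isHomotopyEquivalence_mapCylRetract f⟩
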